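/- Let $K$ be a field, $n\ge 2$, $a\in K\setminus\{0,-1\}$ and $d=\frac{1}{a+1}$. Let $L=(L_1,L_2,\dots)$ be a sequence of natural numbers with $L_1=n$ and $L_{j+1}-L_j\in\{n,n+1\}$ for all $j\ge 1$. Consider matrices over $K$ indexed by $\mathbb{N}_0\times\mathbb{N}_0$ whose rows have only finitely many non-zero entries, let $E_j$ be the row vector with $(E_j)_i=\delta_{ij}$, let $Y$ be the matrix with rows $Y_{i,*}=E_{i+1}$, let $\widetilde M=M(L)$ be the matrix with rows $$ \widetilde M_{j,*}=\begin{cases} E_0-E_1, & j<L_1,\\ d^k(E_0-E_1), & L_k<j<L_{k+1},\\ d^kE_0-d^{k-1}E_1+aE_{L_k+1}, & j=L_k,\end{cases} $$ and set $M=\widetilde M+Y$. Let $\tau_M\colon K[y]\otimes K[x]\to K[x]\otimes K[y]$ be the linear map with $\tau_M(y^r\otimes x^i)=\sum_j (M^i)_{rj}\,x^{r+i-j}\otimes y^j$. A twisting map of $K[x]$ with $K[y]$ is a linear map $\tau\colon K[y]\otimes K[x]\to K[x]\otimes K[y]$ with $\tau(1\otimes f)=f\otimes 1$, $\tau(g\otimes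 1)=1\otimes g$, $\tau\circ(\mathrm{id}\otimes\mu_{K[x]})=(\mu_{K[x]}\otimes \mathrm{id})(\mathrm{id}\otimes\tau)(\tau\otimes \mathrm{id})$ and $\tau\circ(\mu_{K[y]}\otimes \mathrm{id})=(\mathrm{id}\otimes\mu_{K[y]})(\tau\otimes \mathrm{id})(\mathrm{id}\otimes\tau)$, where $\mu$ denotes multiplication; it is graded if each $\tau(y^r\otimes x^i)$ is a linear combination of the elements $x^{i+r-j}\otimes y^j$, $0\le j\le i+r$. Call $L$ quasi-balanced if $L_r-1\le L_j+L_{r-j}\le L_r$ for all $0<j<r$. Then each of the following three conditions holds if and only if $L$ is quasi-balanced: 1. $\tau_M$ is a graded twisting map; 2. $M_{0j}=\delta_{0j}$, $M_{kj}=0$ for $j>k+1$, and $Y^kM=\sum_{j=0}^{k+1}M_{kj}M^{k+1-j}Y^j$ for all $k\ge 0$; 3. there is a graded twisting map $\tau$ of $K[x]$ with $K[y]$ such that $\tau(y^k\otimes x)=\sum_{j=0}^{k+1}M_{kj}\,x^{k+1-j}\otimes y^j$ for all $k\ge 0$. If $L$ is quasi-balanced, then $\tau_M(y^k\otimes x)=\sum_{j=0}^{k+1}M_{kj}\,x^{k+1-j}\otimes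 y^j$ for all $k\ge 0$, and the multiplication $(\mu_{K[x]}\otimes\mu_{K[y]})\circ(\mathrm{id}\otimes\tau_M\otimes\mathrm{id})$ on $K[x]\otimes K[y]$ is a twisted tensor product $B(a,L)$: it is associative with unit $1\otimes 1$, the canonical maps from $K[x]$ and $K[y]$ are algebra maps, $(f\otimes 1)(1\otimes g)=f\otimes g$, and $(1\otimes y^k)(x\otimes 1)=\sum_{j=0}^{k+1}M_{kj}\,x^{k+1-j}\otimes y^j$ for all $k\ge 0$. -/

import Mathlib

open scoped TensorProduct Polynomial

/-! ### Twisting maps and twisted tensor products -/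

section Twisting

variable {K A B : Type*} [Field K] [Ring A] [Algebra K A] [Ring B] [Algebra K B]

/-- A twisting map of `A` with `B`: a linear map `τ : B ⊗ A → A ⊗ B` compatible with the units and
the multiplications of `A` and `B`. -/
structure IsTwistingMap (τ : B ⊗[K] A →ₗ[K] A ⊗[K] B) : Prop where
  /-- `τ(1 ⊗ a) = a ⊗ 1` -/
  one_tmul : ∀ a : A, τ ((1 : B) ⊗ₜ[K] a) = a ⊗ₜ[K] (1 : B)
  /-- `τ(b ⊗ 1) = 1 ⊗ b` -/
  tmul_one : ∀ b : B, τ (b ⊗ₜ[K] (1 : A)) = (1 : A) ⊗ₜ[K] b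
  /-- `τ ∘ (B ⊗ μ_A) = (μ_A ⊗ B) ∘ (A ⊗ τ) ∘ (τ ⊗ A)` -/
  tmul_mul :
    τ ∘ₗ LinearMap.lTensor B (LinearMap.mul' K A) ∘ₗ (TensorProduct.assoc K B A A).toLinearMap =
      LinearMap.rTensor B (LinearMap.mul' K A) ∘ₗ (TensorProduct.assoc K A A B).symm.toLinearMap ∘ₗ
        LinearMap.lTensor A τ ∘ₗ (TensorProduct.assoc K A B A).toLinearMap ∘ₗ
        LinearMap.rTensor A τ
  /-- `τ ∘ (μ_B ⊗ A) = (A ⊗ μ_B) ∘ (τ ⊗ B) ∘ (B ⊗ τ)` -/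
  mul_tmul :
    τ ∘ₗ LinearMap.rTensor A (LinearMap.mul' K B) =
      LinearMap.lTensor A (LinearMap.mul' K B) ∘ₗ (TensorProduct.assoc K A B B).toLinearMap ∘ₗ
        LinearMap.rTensor B τ ∘ₗ (TensorProduct.assoc K B A B).symm.toLinearMap ∘ₗ
        LinearMap.lTensor B τ ∘ₗ (TensorProduct.assoc K B B A).toLinearMap

/-- A bilinear multiplication on `A ⊗ B` is a twisted tensor product of `A` with `B` if it is
associative and unital, the canonical maps `A → A ⊗ B` and `B → A ⊗ B` are algebra maps and
`i_A(a) i_B(b) = a ⊗ b`. -/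
structure IsTwistedTensorProduct (mul : A ⊗[K] B →ₗ[K] A ⊗[K] B →ₗ[K] A ⊗[K] B) : Prop where
  assoc : ∀ u v w, mul (mul u v) w = mul u (mul v w)
  one_mul : ∀ u, mul ((1 : A) ⊗ₜ[K] (1 : B)) u = u
  mul_one : ∀ u, mul u ((1 : A) ⊗ₜ[K] (1 : B)) = u
  inclA_mul : ∀ a a' : A,
    mul (a ⊗ₜ[K] (1 : B)) (a' ⊗ₜ[K] (1 : B)) = (a * a') ⊗ₜ[K] (1 : B)
  inclB_mul : ∀ b b' : B,
    mul ((1 : A) ⊗ₜ[K] b) ((1 : A) ⊗ₜ[K] b') = (1 : A) ⊗ₜ[K] (b * b')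
  inclA_mul_inclB : ∀ (a : A) (b : B),
    mul (a ⊗ₜ[K] (1 : B)) ((1 : A) ⊗ₜ[K] b) = a ⊗ₜ[K] b

/-- The multiplication `(μ_A ⊗ μ_B) ∘ (A ⊗ τ ⊗ B)` on `A ⊗ B`. -/
noncomputable def twistedMul (τ : B ⊗[K] A →ₗ[K] A ⊗[K] B) :
    A ⊗[K] B →ₗ[K] A ⊗[K] B →ₗ[K] A ⊗[K] B :=
  TensorProduct.curry
    (TensorProduct.map (LinearMap.mul' K A) (LinearMap.mul' K B) ∘ₗ
      (TensorProduct.assoc K (A ⊗[K] A) B B).toLinearMap ∘ₗ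
      LinearMap.rTensor B
        ((TensorProduct.assoc K A A B).symm.toLinearMap ∘ₗ LinearMap.lTensor A τ ∘ₗ
          (TensorProduct.assoc K A B A).toLinearMap) ∘ₗ
      (TensorProduct.assoc K (A ⊗[K] B) A B).symm.toLinearMap)

end Twisting

/-! ### Infinite matrices with finite rows -/

section InfMat

variable {K : Type*} [Field K]

/-- Matrices indexed by `ℕ × ℕ` all of whose rows have finitely many non-zero entries; `A i` is the
`i`-th row and `A i j` is the entry `(i, j)`. -/
abbrev InfMat (K : Type*) [Field K] : Type _ := ℕ → ℕ →₀ K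

/-- The matrix product, `(A B)_{i,*} = ∑_k A_{ik} B_{k,*}`. -/
noncomputable def infMul (A B : InfMat K) : InfMat K :=
  fun i => (A i).sum fun k c => c • B k

/-- The powers of a matrix for the matrix product. -/
noncomputable def infPow (A : InfMat K) : ℕ → InfMat K
  | 0 => fun i => Finsupp.single i 1
  | m + 1 => infMul (infPow A m) A

/-- The shift matrix `Y`, with `Y_{i,i+1} = 1` and all other entries zero. -/
noncomputable def shiftY (K : Type*) [Field K] : InfMat K :=
  fun i => Finsupp.single (i + 1) 1

/-- The conditions `M_{0j} = δ_{0j}`, `M_{kj} = 0` for `j > k + 1`, and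
`Y^k M = ∑_{j=0}^{k+1} M_{kj} M^{k+1-j} Y^j` for all `k`. -/
structure IsGradedTwistingMatrix (M : InfMat K) : Prop where
  row_zero : M 0 = Finsupp.single 0 1
  hessenberg : ∀ k j, k + 1 < j → M k j = 0
  shift_mul : ∀ k, infMul (infPow (shiftY K) k) M =
    ∑ j ∈ Finset.range (k + 2), M k j • infMul (infPow M (k + 1 - j)) (infPow (shiftY K) j)

end InfMat

/-! ### Graded twisting maps of `K[x]` with `K[y]`

Both polynomial rings are `K[X]`; in `τ : K[y] ⊗ K[x] → K[x] ⊗ K[y]` the roles are given by the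
position of the factor. -/

section Graded

variable {K : Type*} [Field K]

/-- `τ` is a twisting map such that every `τ(y^r ⊗ x^i)` is a linear combination of the elements
`x^{i+r-j} ⊗ y^j`, `0 ≤ j ≤ i + r`. -/
structure IsGradedTwistingMap (τ : K[X] ⊗[K] K[X] →ₗ[K] K[X] ⊗[K] K[X]) : Prop where
  isTwistingMap : IsTwistingMap τ
  graded : ∀ r i : ℕ, ∃ c : ℕ → K,
    τ ((Polynomial.X ^ r) ⊗ₜ[K] (Polynomial.X ^ i)) =
      ∑ j ∈ Finset.range (i + r + 1),
        c j • ((Polynomial.X ^ (i + r - j) : K[X]) ⊗ₜ[K] (Polynomial.X ^ j : K[X]))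

/-- `M` is the matrix of `τ`: `τ(y^k ⊗ x) = ∑_{j=0}^{k+1} M_{kj} x^{k+1-j} ⊗ y^j` for all `k`. -/
def HasMatrix (τ : K[X] ⊗[K] K[X] →ₗ[K] K[X] ⊗[K] K[X]) (M : InfMat K) : Prop :=
  ∀ k : ℕ, τ ((Polynomial.X ^ k) ⊗ₜ[K] Polynomial.X) =
    ∑ j ∈ Finset.range (k + 2),
      M k j • ((Polynomial.X ^ (k + 1 - j) : K[X]) ⊗ₜ[K] (Polynomial.X ^ j : K[X]))

/-- The linear map `τ_M` with `τ_M(y^r ⊗ x^i) = ∑_j (M^i)_{rj} x^{r+i-j} ⊗ y^j`. (If `M_{kj} = 0`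
for `j > k + 1`, only `j ≤ r + i` contribute.) -/
noncomputable def twistOfMatrix (M : InfMat K) : K[X] ⊗[K] K[X] →ₗ[K] K[X] ⊗[K] K[X] :=
  TensorProduct.lift
    ((Polynomial.basisMonomials K).constr K fun r =>
      (Polynomial.basisMonomials K).constr K fun i =>
        (infPow M i r).sum fun j c =>
          c • ((Polynomial.X ^ (r + i - j) : K[X]) ⊗ₜ[K] (Polynomial.X ^ j : K[X])))

end Graded

/-! ### The sequences and the matrices `M(L)`

A sequence `L_1, L_2, …` is a function `L : ℕ → ℕ`; the value `L 0` is never used. -/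

/-- `L_1 = n` and `L_{j+1} - L_j ∈ {n, n+1}` for all `j ≥ 1`. -/
def IsDeltaSeq (n : ℕ) (L : ℕ → ℕ) : Prop :=
  L 1 = n ∧ ∀ j, 1 ≤ j → L (j + 1) = L j + n ∨ L (j + 1) = L j + (n + 1)

/-- `L_r - 1 ≤ L_j + L_{r-j} ≤ L_r` for all `0 < j < r`. -/
def IsQuasiBalanced (L : ℕ → ℕ) : Prop :=
  ∀ r j, 0 < j → j < r → L r ≤ L j + L (r - j) + 1 ∧ L j + L (r - j) ≤ L r

/-- The number of indices `1 ≤ k ≤ j` with `L_k ≤ j`. For a sequence as above with `n ≥ 1` this is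
the `k` with `L_k ≤ j < L_{k+1}`, and it is `0` if `j < L_1`. -/
def levelOf (L : ℕ → ℕ) (j : ℕ) : ℕ :=
  ((Finset.Icc 1 j).filter fun k => L k ≤ j).card

section MatrixOfSeq

variable {K : Type*} [Field K]

/-- The matrix `M(L)`, with `d = 1 / (a + 1)`; its rows are computed in `matOfSeq_of_lt`,
`matOfSeq_of_between` and `matOfSeq_of_eq`. -/
noncomputable def matOfSeq (a : K) (L : ℕ → ℕ) : InfMat K := fun j =>
  if 1 ≤ levelOf L j ∧ L (levelOf L j) = j then
    Finsupp.single 0 ((1 / (a + 1)) ^ levelOf L j)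
      - Finsupp.single 1 ((1 / (a + 1)) ^ (levelOf L j - 1)) + Finsupp.single (j + 1) a
  else
    (1 / (a + 1)) ^ levelOf L j • (Finsupp.single 0 1 - Finsupp.single 1 1)

theorem IsDeltaSeq.strictMono {n : ℕ} {L : ℕ → ℕ} (hn : 1 ≤ n) (hL : IsDeltaSeq n L)
    {i j : ℕ} (hi : 1 ≤ i) (hij : i < j) : L i < L j := by
  induction j, hij using Nat.le_induction with
  | base =>
    change L i < L (i + 1)
    rcases hL.2 i hi with h | h <;> omega
  | succ m hm ih => rcases hL.2 m (by omega) with h | h <;> omega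

theorem IsDeltaSeq.le_apply {n : ℕ} {L : ℕ → ℕ} (hn : 1 ≤ n) (hL : IsDeltaSeq n L)
    {k : ℕ} (hk : 1 ≤ k) : k ≤ L k := by
  induction k, hk using Nat.le_induction with
  | base => rw [hL.1]; exact hn
  | succ m hm ih => rcases hL.2 m hm with h | h <;> omega

theorem IsDeltaSeq.levelOf_eq {n : ℕ} {L : ℕ → ℕ} (hn : 1 ≤ n) (hL : IsDeltaSeq n L)
    {j k : ℕ} (h1 : 1 ≤ k → L k ≤ j) (h2 : j < L (k + 1)) : levelOf L j = k := by
  have : (Finset.Icc 1 j).filter (fun i => L i ≤ j) = Finset.Icc 1 k := by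
    ext i
    simp only [Finset.mem_filter, Finset.mem_Icc]
    constructor
    · rintro ⟨⟨hi, -⟩, hij⟩
      refine ⟨hi, ?_⟩
      by_contra hc
      rcases Nat.lt_or_ge (k + 1) i with h | h
      · have := hL.strictMono hn (by omega) h
        omega
      · have : i = k + 1 := by omega
        subst this
        omega
    · rintro ⟨hi, hik⟩
      have hk := h1 (by omega)
      have hle : L i ≤ L k := by
        rcases Nat.lt_or_ge i k with h | h
        · exact (hL.strictMono hn hi h).le
        · rw [le_antisymm hik h]
      have := hL.le_apply hn hi
      omega
  rw [levelOf, this, Nat.card_Icc]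
  omega

/-- The rows above `L_1` are `E_0 - E_1`. -/
theorem matOfSeq_of_lt {n : ℕ} {L : ℕ → ℕ} (hn : 1 ≤ n) (hL : IsDeltaSeq n L) (a : K)
    {j : ℕ} (hj : j < L 1) :
    matOfSeq a L j = Finsupp.single 0 1 - Finsupp.single 1 1 := by
  have h := hL.levelOf_eq hn (j := j) (k := 0) (by omega) hj
  simp [matOfSeq, h]

/-- The rows strictly between `L_k` and `L_{k+1}` are `d^k (E_0 - E_1)`. -/
theorem matOfSeq_of_between {n : ℕ} {L : ℕ → ℕ} (hn : 1 ≤ n) (hL : IsDeltaSeq n L) (a : K)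
    {j k : ℕ} (h1 : L k < j) (h2 : j < L (k + 1)) :
    matOfSeq a L j = (1 / (a + 1)) ^ k • (Finsupp.single 0 1 - Finsupp.single 1 1) := by
  have h := hL.levelOf_eq hn (j := j) (k := k) (fun _ => h1.le) h2
  have h' : ¬ (1 ≤ k ∧ L k = j) := by omega
  simp only [matOfSeq, h, if_neg h']

/-- The row `L_k` is `d^k E_0 - d^(k-1) E_1 + a E_{L_k + 1}`. -/
theorem matOfSeq_of_eq {n : ℕ} {L : ℕ → ℕ} (hn : 1 ≤ n) (hL : IsDeltaSeq n L) (a : K)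
    {k : ℕ} (hk : 1 ≤ k) :
    matOfSeq a L (L k) = Finsupp.single 0 ((1 / (a + 1)) ^ k)
      - Finsupp.single 1 ((1 / (a + 1)) ^ (k - 1)) + Finsupp.single (L k + 1) a := by
  have h := hL.levelOf_eq hn (j := L k) (k := k) (fun _ => le_rfl)
    (hL.strictMono hn hk (Nat.lt_succ_self k))
  simp only [matOfSeq, h]
  rw [if_pos ⟨hk, trivial⟩]

end MatrixOfSeq

/-! ### Twisting maps in terms of the twisted multiplication -/

section Twisting

variable {K A B : Type*} [Field K] [Ring A] [Algebra K A] [Ring B] [Algebra K B]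

/-! Let `c j` be the number of `r ≥ 1` with `L r < j`. Since `a + 1 = d⁻¹`, all cases of the
definition of `M` merge into one row formula, `d^{c(j+1)} E_0 - d^{c(j)} E_1 + d^{c(j)-c(j+1)}
E_{j+1}` (`matOfSeq_add_shiftY`).

A graded twisting map amounts to a matrix. On vectors supported in `j ≤ N`, read as `∑ v_j x^{N-j} ⊗
y^j`, right multiplication by `x` is `M`, right multiplication by `y` is the shift, and left
multiplication by `y^i` is `shiftComb`. The twisting axioms then reduce to the relations for `Y^k
M`; the conditions on row zero and on `j > k + 1` hold for this `M` in any case, so all three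
conditions amount to these relations.

The powers of `M` have a closed form with at most three terms per row. Put `s = c(i+k) - c(i) -
c(k)`. The `E_1` entries of the relations say `d^s = 1 - (1-d)s` when `i + k ≥ 1`. This is true for
`s = 0, 1`, and for `s = -1, 2` it would force `(d-1)^2 = 0`. As `k` grows by one, `s` starts at `0`
and moves by at most one, so it never leaves `{0, 1}`; conversely `s ∈ {0, 1}` gives every entry
(`countMat_shift_iff`). Since `c` counts the values of `L`, this bound on `s` is quasi-balancedness
of `L` (`IsDeltaSeq.isQuasiBalanced_iff`). -/

theorem twistedMul_tmul (τ : B ⊗[K] A →ₗ[K] A ⊗[K] B) (a a' : A) (b b' : B) :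
    twistedMul τ (a ⊗ₜ[K] b) (a' ⊗ₜ[K] b') =
      TensorProduct.map (LinearMap.mulLeft K a) (LinearMap.mulRight K b') (τ (b ⊗ₜ[K] a')) := by
  simp only [twistedMul, TensorProduct.curry_apply, LinearMap.comp_apply, LinearEquiv.coe_coe,
    TensorProduct.assoc_symm_tmul, LinearMap.rTensor_tmul, TensorProduct.assoc_tmul,
    LinearMap.lTensor_tmul]
  induction τ (b ⊗ₜ[K] a') with
  | zero => simp
  | tmul p q => simp
  | add p q hp hq => simp only [TensorProduct.tmul_add, TensorProduct.add_tmul, map_add, hp, hq]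

/-- Turns the right side of the axiom `tmul_mul` into right multiplication by `a ⊗ 1`; the next
lemma does the same for `mul_tmul` and left multiplication by `1 ⊗ b`. -/
theorem rTensor_mul_lTensor_twist (τ : B ⊗[K] A →ₗ[K] A ⊗[K] B) (w : A ⊗[K] B) (a : A) :
    LinearMap.rTensor B (LinearMap.mul' K A) ((TensorProduct.assoc K A A B).symm
      (LinearMap.lTensor A τ (TensorProduct.assoc K A B A (w ⊗ₜ[K] a)))) =
    twistedMul τ w (a ⊗ₜ[K] 1) := by
  induction w with
  | zero => simp
  | add p q hp hq => simp only [TensorProduct.add_tmul, map_add, hp, hq, LinearMap.add_apply]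
  | tmul p q =>
    rw [twistedMul_tmul]
    simp only [TensorProduct.assoc_tmul, LinearMap.lTensor_tmul]
    induction τ (q ⊗ₜ[K] a) with
    | zero => simp
    | tmul s t => simp
    | add s t hs ht => simp only [TensorProduct.tmul_add, map_add, hs, ht]

theorem lTensor_mul_rTensor_twist (τ : B ⊗[K] A →ₗ[K] A ⊗[K] B) (b : B) (w : A ⊗[K] B) :
    LinearMap.lTensor A (LinearMap.mul' K B) (TensorProduct.assoc K A B B
      (LinearMap.rTensor B τ ((TensorProduct.assoc K B A B).symm (b ⊗ₜ[K] w)))) =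
    twistedMul τ (1 ⊗ₜ[K] b) w := by
  induction w with
  | zero => simp
  | add p q hp hq => simp only [TensorProduct.tmul_add, map_add, hp, hq]
  | tmul p q =>
    rw [twistedMul_tmul]
    simp only [TensorProduct.assoc_symm_tmul, LinearMap.rTensor_tmul]
    induction τ (b ⊗ₜ[K] p) with
    | zero => simp
    | tmul s t => simp
    | add s t hs ht => simp only [TensorProduct.add_tmul, map_add, hs, ht]

variable {τ : B ⊗[K] A →ₗ[K] A ⊗[K] B}

theorem IsTwistingMap.apply_tmul_mul (h : IsTwistingMap τ) (b : B) (a a' : A) :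
    τ (b ⊗ₜ[K] (a * a')) = twistedMul τ (τ (b ⊗ₜ[K] a)) (a' ⊗ₜ[K] 1) := by
  have := LinearMap.congr_fun h.tmul_mul ((b ⊗ₜ[K] a) ⊗ₜ[K] a')
  simpa [rTensor_mul_lTensor_twist] using this

theorem IsTwistingMap.apply_mul_tmul (h : IsTwistingMap τ) (b b' : B) (a : A) :
    τ ((b * b') ⊗ₜ[K] a) = twistedMul τ (1 ⊗ₜ[K] b) (τ (b' ⊗ₜ[K] a)) := by
  have := LinearMap.congr_fun h.mul_tmul ((b ⊗ₜ[K] b') ⊗ₜ[K] a)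
  simpa [lTensor_mul_rTensor_twist] using this

/-- The outer factors never pass through `τ`, so for any linear `τ` the product is left `A`-linear
and, by the companion lemma, right `B`-linear. -/
theorem twistedMul_map_mulLeft (τ : B ⊗[K] A →ₗ[K] A ⊗[K] B) (a : A) (u v : A ⊗[K] B) :
    twistedMul τ (TensorProduct.map (LinearMap.mulLeft K a) LinearMap.id u) v =
      TensorProduct.map (LinearMap.mulLeft K a) LinearMap.id (twistedMul τ u v) := by
  induction u with
  | zero => simp
  | add p q hp hq => simp only [map_add, LinearMap.add_apply, hp, hq]
  | tmul p q =>
    induction v with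
    | zero => simp
    | add s t hs ht => simp only [map_add, hs, ht]
    | tmul s t =>
      simp only [TensorProduct.map_tmul, twistedMul_tmul, LinearMap.mulLeft_apply,
        LinearMap.id_apply, TensorProduct.map_map, LinearMap.mulLeft_mul, LinearMap.id_comp]

theorem twistedMul_map_mulRight (τ : B ⊗[K] A →ₗ[K] A ⊗[K] B) (b : B) (u v : A ⊗[K] B) :
    twistedMul τ u (TensorProduct.map LinearMap.id (LinearMap.mulRight K b) v) =
      TensorProduct.map LinearMap.id (LinearMap.mulRight K b) (twistedMul τ u v) := by
  induction u with
  | zero => simp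
  | add p q hp hq => simp only [map_add, LinearMap.add_apply, hp, hq]
  | tmul p q =>
    induction v with
    | zero => simp
    | add s t hs ht => simp only [map_add, hs, ht]
    | tmul s t =>
      simp only [TensorProduct.map_tmul, twistedMul_tmul, LinearMap.mulRight_apply,
        LinearMap.id_apply, TensorProduct.map_map, LinearMap.mulRight_mul, LinearMap.id_comp]

theorem twistedMul_one_tmul_tmul_one (τ : B ⊗[K] A →ₗ[K] A ⊗[K] B) (b : B) (a : A) :
    twistedMul τ (1 ⊗ₜ[K] b) (a ⊗ₜ[K] 1) = τ (b ⊗ₜ[K] a) := by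
  simp [twistedMul_tmul]

/-- By left `A`-linearity it suffices to take `w = 1 ⊗ q`, where this is the axiom `mul_tmul`. -/
theorem IsTwistingMap.twistedMul_mulRight_left (h : IsTwistingMap τ) (b : B) (a : A)
    (w : A ⊗[K] B) :
    twistedMul τ (TensorProduct.map LinearMap.id (LinearMap.mulRight K b) w) (a ⊗ₜ[K] 1) =
      twistedMul τ w (τ (b ⊗ₜ[K] a)) := by
  induction w with
  | zero => simp
  | add p q hp hq => simp only [map_add, LinearMap.add_apply, hp, hq]
  | tmul p q =>
    have hp : p ⊗ₜ[K] q =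
        TensorProduct.map (LinearMap.mulLeft K p) LinearMap.id ((1 : A) ⊗ₜ[K] q) := by simp
    rw [hp, twistedMul_map_mulLeft, ← h.apply_mul_tmul, TensorProduct.map_tmul,
      TensorProduct.map_tmul, twistedMul_tmul]
    simp

theorem IsTwistingMap.twistedMul_mulLeft_right (h : IsTwistingMap τ) (b : B) (a : A)
    (w : A ⊗[K] B) :
    twistedMul τ (1 ⊗ₜ[K] b) (TensorProduct.map (LinearMap.mulLeft K a) LinearMap.id w) =
      twistedMul τ (τ (b ⊗ₜ[K] a)) w := by
  induction w with
  | zero => simp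
  | add p q hp hq => simp only [map_add, hp, hq]
  | tmul p q =>
    have hp : p ⊗ₜ[K] q =
        TensorProduct.map LinearMap.id (LinearMap.mulRight K q) (p ⊗ₜ[K] (1 : B)) := by simp
    rw [hp, twistedMul_map_mulRight, ← h.apply_tmul_mul, TensorProduct.map_tmul,
      TensorProduct.map_tmul, twistedMul_tmul]
    simp

theorem IsTwistingMap.twistedMul_assoc (h : IsTwistingMap τ) (u v w : A ⊗[K] B) :
    twistedMul τ (twistedMul τ u v) w = twistedMul τ u (twistedMul τ v w) := by
  induction u with
  | zero => simp
  | add p q hp hq => simp only [map_add, LinearMap.add_apply, hp, hq]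
  | tmul a b =>
  induction v with
  | zero => simp
  | add p q hp hq => simp only [map_add, LinearMap.add_apply, hp, hq]
  | tmul a' b' =>
  induction w with
  | zero => simp
  | add p q hp hq => simp only [map_add, hp, hq]
  | tmul a'' b'' =>
    have ha : a ⊗ₜ[K] b =
        TensorProduct.map (LinearMap.mulLeft K a) LinearMap.id ((1 : A) ⊗ₜ[K] b) := by simp
    have hb : a'' ⊗ₜ[K] b'' =
        TensorProduct.map LinearMap.id (LinearMap.mulRight K b'') (a'' ⊗ₜ[K] (1 : B)) := by simp
    have ha' : a' ⊗ₜ[K] b' =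
        TensorProduct.map (LinearMap.mulLeft K a') LinearMap.id ((1 : A) ⊗ₜ[K] b') := by simp
    have hb' : a' ⊗ₜ[K] b' =
        TensorProduct.map LinearMap.id (LinearMap.mulRight K b') (a' ⊗ₜ[K] (1 : B)) := by simp
    -- After the outer `a` and `b''` are pulled out, both bracketings equal `τ(b ⊗ a') · τ(b' ⊗
    -- a'')`.
    have key : twistedMul τ (twistedMul τ ((1 : A) ⊗ₜ[K] b) (a' ⊗ₜ[K] b')) (a'' ⊗ₜ[K] (1 : B)) =
        twistedMul τ ((1 : A) ⊗ₜ[K] b) (twistedMul τ (a' ⊗ₜ[K] b') (a'' ⊗ₜ[K] (1 : B))) := by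
      calc _ = twistedMul τ (τ (b ⊗ₜ[K] a')) (τ (b' ⊗ₜ[K] a'')) := by
            rw [hb', twistedMul_map_mulRight, h.twistedMul_mulRight_left,
              twistedMul_one_tmul_tmul_one]
        _ = _ := by
            rw [ha', twistedMul_map_mulLeft, h.twistedMul_mulLeft_right,
              twistedMul_one_tmul_tmul_one]
    rw [ha, hb, twistedMul_map_mulLeft, twistedMul_map_mulLeft, twistedMul_map_mulLeft,
      twistedMul_map_mulRight, twistedMul_map_mulRight, twistedMul_map_mulRight, key]

theorem IsTwistingMap.isTwistedTensorProduct (h : IsTwistingMap τ) :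
    IsTwistedTensorProduct (twistedMul τ) where
  assoc := h.twistedMul_assoc
  one_mul u := by
    induction u with
    | zero => simp
    | add p q hp hq => simp only [map_add, hp, hq]
    | tmul a b => simp [twistedMul_tmul, h.one_tmul]
  mul_one u := by
    induction u with
    | zero => simp
    | add p q hp hq => simp only [map_add, LinearMap.add_apply, hp, hq]
    | tmul a b => simp [twistedMul_tmul, h.tmul_one]
  inclA_mul a a' := by simp [twistedMul_tmul, h.one_tmul]
  inclB_mul b b' := by simp [twistedMul_tmul, h.tmul_one]
  inclA_mul_inclB a b := by simp [twistedMul_tmul, h.one_tmul]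

end Twisting

/-! ### Matrices acting on row vectors -/

section RowAction

variable {K : Type*} [Field K]

/-- The action `v ↦ v A` of a matrix on row vectors. -/
noncomputable def rowAct (A : InfMat K) : Module.End K (ℕ →₀ K) :=
  Finsupp.linearCombination K A

@[simp]
theorem rowAct_single_one (A : InfMat K) (i : ℕ) : rowAct A (Finsupp.single i 1) = A i := by
  simp [rowAct]

theorem infMul_apply (A B : InfMat K) (i : ℕ) : infMul A B i = rowAct B (A i) := rfl

theorem infPow_apply (A : InfMat K) (m i : ℕ) :
    infPow A m i = (rowAct A ^ m) (Finsupp.single i 1) := by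
  induction m with
  | zero => rfl
  | succ m ih => rw [pow_succ', Module.End.mul_apply, ← ih]; rfl

theorem rowAct_shiftY_pow_single (k i : ℕ) (c : K) :
    (rowAct (shiftY K) ^ k) (Finsupp.single i c) = Finsupp.single (i + k) c := by
  induction k with
  | zero => rfl
  | succ k ih =>
    rw [pow_succ', Module.End.mul_apply, ih]
    simp [rowAct, shiftY, add_assoc]

/-- Exponents such as `N - j` use truncated subtraction, so identities involving them are checked
only on basis vectors with `j ≤ N`. -/
theorem LinearMap.eq_of_support_le {V : Type*} [AddCommGroup V] [Module K V]
    {f g : (ℕ →₀ K) →ₗ[K] V} {N : ℕ}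
    (h : ∀ j ≤ N, f (Finsupp.single j 1) = g (Finsupp.single j 1)) {v : ℕ →₀ K}
    (hv : ∀ j, N < j → v j = 0) : f v = g v := by
  have hs : ∀ j ∈ v.support, j ≤ N := by
    intro j hj
    by_contra hc
    exact Finsupp.mem_support_iff.1 hj (hv j (by omega))
  rw [← Finsupp.sum_single v, Finsupp.sum, map_sum, map_sum]
  refine Finset.sum_congr rfl fun j hj => ?_
  rw [← mul_one (v j), ← smul_eq_mul, ← Finsupp.smul_single, map_smul, map_smul, h j (hs j hj)]

theorem rowAct_apply_eq_zero {M : InfMat K} (hM : ∀ k j, k + 1 < j → M k j = 0) {N : ℕ}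
    {v : ℕ →₀ K} (hv : ∀ j, N < j → v j = 0) (j : ℕ) (hj : N + 1 < j) : rowAct M v j = 0 := by
  have := LinearMap.eq_of_support_le (f := Finsupp.lapply j ∘ₗ rowAct M) (g := 0) (N := N)
    (fun k hk => by simpa using hM k j (by omega)) hv
  simpa using this

theorem rowAct_pow_apply_eq_zero {M : InfMat K} (hM : ∀ k j, k + 1 < j → M k j = 0) (m : ℕ)
    {N : ℕ} {v : ℕ →₀ K} (hv : ∀ j, N < j → v j = 0) :
    ∀ j, N + m < j → (rowAct M ^ m) v j = 0 := by
  induction m with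
  | zero => simpa using hv
  | succ m ih =>
    rw [pow_succ', Module.End.mul_apply]
    exact rowAct_apply_eq_zero hM ih

theorem rowAct_pow_single_eq_zero {M : InfMat K} (hM : ∀ k j, k + 1 < j → M k j = 0) (m r : ℕ) :
    ∀ j, r + m < j → (rowAct M ^ m) (Finsupp.single r 1) j = 0 :=
  rowAct_pow_apply_eq_zero hM m fun j hj => Finsupp.single_eq_of_ne (by omega)

theorem linearCombination_eq_sum_range {V : Type*} [AddCommGroup V] [Module K V] (f : ℕ → V)
    {N : ℕ} {v : ℕ →₀ K} (hv : ∀ j, N < j → v j = 0) :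
    Finsupp.linearCombination K f v = ∑ j ∈ Finset.range (N + 1), v j • f j := by
  rw [Finsupp.linearCombination_apply, Finsupp.sum_of_support_subset]
  · intro j hj
    by_contra hc
    exact Finsupp.mem_support_iff.1 hj (hv j (by simpa using hc))
  · simp

/-- The linear map with `E_j ↦ E_i M^{N-j} Y^j`. -/
noncomputable def shiftComb (M : InfMat K) (N i : ℕ) : Module.End K (ℕ →₀ K) :=
  Finsupp.linearCombination K fun j =>
    (rowAct (shiftY K) ^ j) ((rowAct M ^ (N - j)) (Finsupp.single i 1))

theorem shiftComb_single (M : InfMat K) (N i j : ℕ) :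
    shiftComb M N i (Finsupp.single j 1) =
      (rowAct (shiftY K) ^ j) ((rowAct M ^ (N - j)) (Finsupp.single i 1)) := by
  simp [shiftComb]

/-- The row `i` of the relation `Y^k M = ∑_j M_{kj} M^{k+1-j} Y^j`. -/
theorem shift_mul_iff {M : InfMat K} (hM : ∀ k j, k + 1 < j → M k j = 0) (k : ℕ) :
    infMul (infPow (shiftY K) k) M =
      ∑ j ∈ Finset.range (k + 2), M k j • infMul (infPow M (k + 1 - j)) (infPow (shiftY K) j) ↔
    ∀ i, M (i + k) = shiftComb M (k + 1) i (M k) := by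
  rw [funext_iff]
  refine forall_congr' fun i => ?_
  have h1 : infMul (infPow (shiftY K) k) M i = M (i + k) := by
    rw [infMul_apply, infPow_apply, rowAct_shiftY_pow_single, rowAct_single_one]
  have h2 : (∑ j ∈ Finset.range (k + 2),
      M k j • infMul (infPow M (k + 1 - j)) (infPow (shiftY K) j)) i =
      shiftComb M (k + 1) i (M k) := by
    rw [shiftComb, linearCombination_eq_sum_range _ (hM k), Finset.sum_apply]
    refine Finset.sum_congr rfl fun j _ => ?_
    rw [Pi.smul_apply, infMul_apply, infPow_apply]
    congr 1
    have : rowAct (infPow (shiftY K) j) = rowAct (shiftY K) ^ j :=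
      Finsupp.lhom_ext' fun l => LinearMap.ext_ring (by simp [infPow_apply])
    rw [this]
  rw [h1, h2]

/-- Moving `M` leftward past `Y^j` by the relation turns `E_i M^{N-j} Y^j M` into `∑_l M_{jl} E_i
M^{N+1-l} Y^l`. In the algebra this reads `(y^i w) x = y^i (w x)`. -/
theorem rowAct_shiftComb {M : InfMat K} (hM : ∀ k j, k + 1 < j → M k j = 0)
    (h : ∀ k i, M (i + k) = shiftComb M (k + 1) i (M k)) (i : ℕ) {N : ℕ} {w : ℕ →₀ K}
    (hw : ∀ j, N < j → w j = 0) :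
    rowAct M (shiftComb M N i w) = shiftComb M (N + 1) i (rowAct M w) := by
  refine LinearMap.eq_of_support_le (f := rowAct M ∘ₗ shiftComb M N i)
    (g := shiftComb M (N + 1) i ∘ₗ rowAct M) (fun j hj => ?_) hw
  have key : rowAct M ∘ₗ (rowAct (shiftY K) ^ j) =
      ∑ l ∈ Finset.range (j + 2),
        M j l • ((rowAct (shiftY K) ^ l) ∘ₗ (rowAct M ^ (j + 1 - l))) := by
    refine Finsupp.lhom_ext' fun s => LinearMap.ext_ring ?_
    simp only [LinearMap.comp_apply, Finsupp.lsingle_apply, LinearMap.sum_apply,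
      LinearMap.smul_apply, rowAct_shiftY_pow_single j s (1 : K), rowAct_single_one]
    rw [h j s, shiftComb, linearCombination_eq_sum_range _ (hM j)]
  simp only [LinearMap.comp_apply, rowAct_single_one, shiftComb_single]
  rw [← LinearMap.comp_apply (rowAct M), key, shiftComb, linearCombination_eq_sum_range _ (hM j),
    LinearMap.sum_apply]
  refine Finset.sum_congr rfl fun l hl => ?_
  rw [Finset.mem_range] at hl
  rw [LinearMap.smul_apply, LinearMap.comp_apply, ← Module.End.mul_apply (rowAct M ^ _),
    ← pow_add, show j + 1 - l + (N - j) = N + 1 - l by omega]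

/-- Matrix form of `y^{i+k} x^m = y^i (y^k x^m)`, which is the axiom `mul_tmul` on monomials. -/
theorem rowAct_pow_single_add {M : InfMat K} (hM : ∀ k j, k + 1 < j → M k j = 0)
    (h : ∀ k i, M (i + k) = shiftComb M (k + 1) i (M k)) (m i k : ℕ) :
    (rowAct M ^ m) (Finsupp.single (i + k) 1) =
      shiftComb M (k + m) i ((rowAct M ^ m) (Finsupp.single k 1)) := by
  induction m with
  | zero => simp [shiftComb_single, rowAct_shiftY_pow_single]
  | succ m ih =>
    rw [pow_succ', Module.End.mul_apply, Module.End.mul_apply, ih,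
      rowAct_shiftComb hM h i (rowAct_pow_single_eq_zero hM m k), add_assoc]

end RowAction

/-! ### Twisting maps of polynomial rings and matrices -/

section PolynomialTwist

variable {K : Type*} [Field K]

open Polynomial

/-- The linear map with `E_j ↦ x^{N-j} ⊗ y^j`. -/
noncomputable def homogTensor (K : Type*) [Field K] (N : ℕ) : (ℕ →₀ K) →ₗ[K] K[X] ⊗[K] K[X] :=
  Finsupp.linearCombination K fun j => (X ^ (N - j) : K[X]) ⊗ₜ[K] (X ^ j : K[X])

theorem homogTensor_single (N j : ℕ) : homogTensor K N (Finsupp.single j 1) =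
    (X ^ (N - j) : K[X]) ⊗ₜ[K] (X ^ j : K[X]) := by
  simp [homogTensor]

theorem homogTensor_injective (N : ℕ) : Function.Injective (homogTensor K N) := by
  intro v w hvw
  -- Setting `x = 1` and reading off the coefficient of `y^j` recovers `v j`, even for `j > N`.
  have key : ∀ j, Polynomial.lcoeff K j ∘ₗ (TensorProduct.lid K K[X]).toLinearMap ∘ₗ
      LinearMap.rTensor K[X] (Polynomial.leval (1 : K)) ∘ₗ homogTensor K N =
      Finsupp.lapply j := by
    intro j
    refine Finsupp.lhom_ext' fun s => LinearMap.ext_ring ?_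
    simp [homogTensor_single, Polynomial.leval_apply, Polynomial.coeff_X_pow,
      Finsupp.single_apply, eq_comm]
  ext j
  have h := congrArg (fun u => (Polynomial.lcoeff K j ∘ₗ (TensorProduct.lid K K[X]).toLinearMap ∘ₗ
      LinearMap.rTensor K[X] (Polynomial.leval (1 : K))) u) hvw
  simpa [← LinearMap.comp_apply, LinearMap.comp_assoc, key] using h

theorem map_mulLeft_homogTensor (p : ℕ) {N : ℕ} {v : ℕ →₀ K} (hv : ∀ j, N < j → v j = 0) :
    TensorProduct.map (LinearMap.mulLeft K (X ^ p)) LinearMap.id (homogTensor K N v) =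
      homogTensor K (N + p) v := by
  refine LinearMap.eq_of_support_le (f := TensorProduct.map (LinearMap.mulLeft K (X ^ p))
    LinearMap.id ∘ₗ homogTensor K N) (fun j hj => ?_) hv
  rw [LinearMap.comp_apply, homogTensor_single, homogTensor_single, TensorProduct.map_tmul,
    LinearMap.mulLeft_apply, ← pow_add, LinearMap.id_apply, show p + (N - j) = N + p - j by omega]

theorem map_mulRight_homogTensor (q N : ℕ) (v : ℕ →₀ K) :
    TensorProduct.map LinearMap.id (LinearMap.mulRight K (X ^ q)) (homogTensor K N v) =
      homogTensor K (N + q) ((rowAct (shiftY K) ^ q) v) := by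
  have : TensorProduct.map LinearMap.id (LinearMap.mulRight K (X ^ q)) ∘ₗ homogTensor K N =
      homogTensor K (N + q) ∘ₗ (rowAct (shiftY K) ^ q) := by
    refine Finsupp.lhom_ext' fun j => LinearMap.ext_ring ?_
    simp only [LinearMap.comp_apply, Finsupp.lsingle_apply, rowAct_shiftY_pow_single,
      homogTensor_single, TensorProduct.map_tmul, LinearMap.mulRight_apply, ← pow_add,
      LinearMap.id_apply, Nat.add_sub_add_right]
  exact LinearMap.congr_fun this v

/-- `τ(y^r ⊗ x^i) = ∑_j (M^i)_{rj} x^{r+i-j} ⊗ y^j`. -/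
def IsTwistOf (τ : K[X] ⊗[K] K[X] →ₗ[K] K[X] ⊗[K] K[X]) (M : InfMat K) : Prop :=
  ∀ r i : ℕ, τ ((X ^ r) ⊗ₜ[K] (X ^ i)) =
    homogTensor K (r + i) ((rowAct M ^ i) (Finsupp.single r 1))

theorem isTwistOf_twistOfMatrix (M : InfMat K) : IsTwistOf (twistOfMatrix M) M := by
  intro r i
  have hX : ∀ s : ℕ, (X ^ s : K[X]) = Polynomial.basisMonomials K s := by
    simp [Polynomial.X_pow_eq_monomial]
  rw [twistOfMatrix, TensorProduct.lift.tmul, hX r, hX i, Module.Basis.constr_basis,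
    Module.Basis.constr_basis, infPow_apply]
  rfl

theorem hasMatrix_iff {τ : K[X] ⊗[K] K[X] →ₗ[K] K[X] ⊗[K] K[X]} {M : InfMat K}
    (hM : ∀ k j, k + 1 < j → M k j = 0) :
    HasMatrix τ M ↔ ∀ k, τ ((X ^ k) ⊗ₜ[K] X) = homogTensor K (k + 1) (M k) := by
  refine forall_congr' fun k => ?_
  rw [homogTensor, linearCombination_eq_sum_range _ (hM k)]

theorem IsTwistOf.hasMatrix {τ : K[X] ⊗[K] K[X] →ₗ[K] K[X] ⊗[K] K[X]} {M : InfMat K}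
    (hM : ∀ k j, k + 1 < j → M k j = 0) (hτ : IsTwistOf τ M) : HasMatrix τ M :=
  (hasMatrix_iff hM).2 fun k => by simpa using hτ k 1

/-- Only the values at the single exponent `m` are assumed, so the case `m = 1` is available in the
induction that computes `τ` on all powers of `x`. -/
theorem twistedMul_homogTensor_left {τ : K[X] ⊗[K] K[X] →ₗ[K] K[X] ⊗[K] K[X]} {M : InfMat K}
    (hM : ∀ k j, k + 1 < j → M k j = 0) (m : ℕ)
    (hτ : ∀ r, τ ((X ^ r) ⊗ₜ[K] (X ^ m)) =
      homogTensor K (r + m) ((rowAct M ^ m) (Finsupp.single r 1)))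
    {N : ℕ} {v : ℕ →₀ K} (hv : ∀ j, N < j → v j = 0) :
    twistedMul τ (homogTensor K N v) ((X ^ m : K[X]) ⊗ₜ[K] (1 : K[X])) =
      homogTensor K (N + m) ((rowAct M ^ m) v) := by
  refine LinearMap.eq_of_support_le
    (f := (twistedMul τ).flip ((X ^ m : K[X]) ⊗ₜ[K] (1 : K[X])) ∘ₗ homogTensor K N)
    (g := homogTensor K (N + m) ∘ₗ (rowAct M ^ m)) (fun j hj => ?_) hv
  rw [LinearMap.comp_apply, LinearMap.flip_apply, homogTensor_single, twistedMul_tmul, hτ,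
    LinearMap.mulRight_one, map_mulLeft_homogTensor _ (rowAct_pow_single_eq_zero hM m j),
    LinearMap.comp_apply, show j + m + (N - j) = N + m by omega]

theorem IsTwistOf.twistedMul_homogTensor_right {τ : K[X] ⊗[K] K[X] →ₗ[K] K[X] ⊗[K] K[X]}
    {M : InfMat K} (hτ : IsTwistOf τ M) (i : ℕ) {N : ℕ} {v : ℕ →₀ K}
    (hv : ∀ j, N < j → v j = 0) :
    twistedMul τ ((1 : K[X]) ⊗ₜ[K] (X ^ i : K[X])) (homogTensor K N v) =
      homogTensor K (N + i) (shiftComb M N i v) := by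
  refine LinearMap.eq_of_support_le
    (f := twistedMul τ ((1 : K[X]) ⊗ₜ[K] (X ^ i : K[X])) ∘ₗ homogTensor K N)
    (g := homogTensor K (N + i) ∘ₗ shiftComb M N i) (fun j hj => ?_) hv
  rw [LinearMap.comp_apply, homogTensor_single, twistedMul_tmul, hτ,
    LinearMap.mulLeft_one, map_mulRight_homogTensor, LinearMap.comp_apply, shiftComb_single,
    show i + (N - j) + j = N + i by omega]

theorem IsTwistingMap.isTwistOf {τ : K[X] ⊗[K] K[X] →ₗ[K] K[X] ⊗[K] K[X]} {M : InfMat K}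
    (hM : ∀ k j, k + 1 < j → M k j = 0) (h : IsTwistingMap τ) (hτ : HasMatrix τ M) :
    IsTwistOf τ M := by
  rw [hasMatrix_iff hM] at hτ
  intro r i
  induction i with
  | zero => simp [h.tmul_one, homogTensor_single]
  | succ i ih =>
    have := twistedMul_homogTensor_left (τ := τ) hM 1 (fun r => by simpa using hτ r)
      (rowAct_pow_single_eq_zero hM i r)
    rw [pow_one, pow_one] at this
    rw [pow_succ X i, h.apply_tmul_mul, ih, this, pow_succ', Module.End.mul_apply, add_assoc]

/-- The matrix of a twisting map satisfies the shift relations. -/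
theorem IsTwistingMap.shift_mul {τ : K[X] ⊗[K] K[X] →ₗ[K] K[X] ⊗[K] K[X]} {M : InfMat K}
    (hM : ∀ k j, k + 1 < j → M k j = 0) (h : IsTwistingMap τ) (hτ : HasMatrix τ M) (k i : ℕ) :
    M (i + k) = shiftComb M (k + 1) i (M k) := by
  have hT := h.isTwistOf hM hτ
  rw [hasMatrix_iff hM] at hτ
  have := h.apply_mul_tmul (X ^ i) (X ^ k) X
  rw [← pow_add, hτ, hτ, hT.twistedMul_homogTensor_right i (hM k),
    show k + 1 + i = i + k + 1 by omega] at this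
  exact homogTensor_injective _ this

theorem IsGradedTwistingMatrix.isTwistingMap {M : InfMat K} (h : IsGradedTwistingMatrix M) :
    IsTwistingMap (twistOfMatrix M) where
  one_tmul f := by
    have hrow : ∀ i : ℕ, (rowAct M ^ i) (Finsupp.single 0 1) = Finsupp.single 0 1 := by
      intro i
      induction i with
      | zero => rfl
      | succ i ih => rw [pow_succ', Module.End.mul_apply, ih, rowAct_single_one, h.row_zero]
    induction f using Polynomial.induction_on' with
    | add p q hp hq => rw [TensorProduct.tmul_add, map_add, hp, hq, TensorProduct.add_tmul]
    | monomial i c =>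
      have := isTwistOf_twistOfMatrix M 0 i
      rw [hrow, homogTensor_single, pow_zero, zero_add, Nat.sub_zero] at this
      rw [← Polynomial.smul_X_eq_monomial, TensorProduct.tmul_smul, map_smul, this,
        TensorProduct.smul_tmul']
  tmul_one f := by
    induction f using Polynomial.induction_on' with
    | add p q hp hq => rw [TensorProduct.add_tmul, map_add, hp, hq, TensorProduct.tmul_add]
    | monomial i c =>
      have := isTwistOf_twistOfMatrix M i 0
      rw [pow_zero, pow_zero, Module.End.one_apply, homogTensor_single, add_zero, Nat.sub_self,
        pow_zero] at this
      rw [← Polynomial.smul_X_eq_monomial, ← TensorProduct.smul_tmul', map_smul, this,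
        TensorProduct.tmul_smul]
  tmul_mul := by
    have hT := isTwistOf_twistOfMatrix M
    refine TensorProduct.ext_threefold fun f g t => ?_
    simp only [LinearMap.comp_apply, LinearEquiv.coe_coe, TensorProduct.assoc_tmul,
      LinearMap.lTensor_tmul, LinearMap.mul'_apply, LinearMap.rTensor_tmul,
      rTensor_mul_lTensor_twist]
    induction f using Polynomial.induction_on' with
    | add p q hp hq => simp only [TensorProduct.add_tmul, map_add, hp, hq, LinearMap.add_apply]
    | monomial r c =>
    induction g using Polynomial.induction_on' with
    | add p q hp hq =>
      simp only [add_mul, TensorProduct.tmul_add, map_add, hp, hq, LinearMap.add_apply]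
    | monomial i d =>
    induction t using Polynomial.induction_on' with
    | add p q hp hq =>
      simp only [mul_add, TensorProduct.tmul_add, TensorProduct.add_tmul, map_add, hp, hq]
    | monomial m e =>
      simp only [← Polynomial.smul_X_eq_monomial, ← TensorProduct.smul_tmul', map_smul,
        smul_mul_assoc, mul_smul_comm, TensorProduct.tmul_smul, LinearMap.smul_apply]
      congr 3
      rw [← pow_add, hT, hT, twistedMul_homogTensor_left h.hessenberg m (fun r => hT r m)
        (rowAct_pow_single_eq_zero h.hessenberg i r), ← Module.End.mul_apply, ← pow_add,
        add_comm m i, add_assoc]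
  mul_tmul := by
    have hT := isTwistOf_twistOfMatrix M
    refine TensorProduct.ext_threefold fun f g t => ?_
    simp only [LinearMap.comp_apply, LinearEquiv.coe_coe, TensorProduct.assoc_tmul,
      LinearMap.lTensor_tmul, LinearMap.mul'_apply, LinearMap.rTensor_tmul,
      lTensor_mul_rTensor_twist]
    induction f using Polynomial.induction_on' with
    | add p q hp hq =>
      simp only [add_mul, TensorProduct.tmul_add, TensorProduct.add_tmul, map_add, hp, hq,
        LinearMap.add_apply]
    | monomial i c =>
    induction g using Polynomial.induction_on' with
    | add p q hp hq => simp only [mul_add, TensorProduct.add_tmul, map_add, hp, hq]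
    | monomial k d =>
    induction t using Polynomial.induction_on' with
    | add p q hp hq => simp only [TensorProduct.tmul_add, map_add, hp, hq]
    | monomial m e =>
      simp only [← Polynomial.smul_X_eq_monomial, ← TensorProduct.smul_tmul', map_smul,
        smul_mul_assoc, mul_smul_comm, TensorProduct.tmul_smul, LinearMap.smul_apply]
      congr 3
      rw [← pow_add, hT, hT, hT.twistedMul_homogTensor_right i
        (rowAct_pow_single_eq_zero h.hessenberg m k),
        ← rowAct_pow_single_add h.hessenberg
          (fun k => (shift_mul_iff h.hessenberg k).1 (h.shift_mul k)),
        show k + m + i = i + k + m by omega]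

theorem IsGradedTwistingMatrix.isGradedTwistingMap {M : InfMat K}
    (h : IsGradedTwistingMatrix M) : IsGradedTwistingMap (twistOfMatrix M) where
  isTwistingMap := h.isTwistingMap
  graded r i := ⟨(rowAct M ^ i) (Finsupp.single r 1), by
    rw [isTwistOf_twistOfMatrix M r i, homogTensor,
      linearCombination_eq_sum_range _ (rowAct_pow_single_eq_zero h.hessenberg i r),
      add_comm r i]⟩

end PolynomialTwist

/-! ### The matrix of a counting function -/

section CountingMatrix

variable {K : Type*} [Field K]

/-- The matrix with rows `d^{c(j+1)} E_0 - d^{c(j)} E_1 + d^{c(j) - c(j+1)} E_{j+1}`. -/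
noncomputable def countMat (d : K) (c : ℕ → ℕ) : InfMat K := fun j =>
  Finsupp.single 0 (d ^ c (j + 1)) - Finsupp.single 1 (d ^ c j) +
    Finsupp.single (j + 1) (d ^ c j * d⁻¹ ^ c (j + 1))

theorem countMat_apply_eq_zero (d : K) (c : ℕ → ℕ) (k j : ℕ) (h : k + 1 < j) :
    countMat d c k j = 0 := by
  simp [countMat, show ¬ 0 = j by omega, show ¬ 1 = j by omega,
    show ¬ k + 1 = j by omega]

variable {d : K} {c : ℕ → ℕ}

/-- The rows of the powers of `countMat`. -/
theorem rowAct_countMat_pow_single (hd : d ≠ 0) (h0 : c 0 = 0) (h1 : c 1 = 0)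
    (hc : ∀ j, c (j + 1) = c j ∨ c (j + 1) = c j + 1) (k i : ℕ) :
    (rowAct (countMat d c) ^ k) (Finsupp.single i 1) =
      Finsupp.single (i + k) (d ^ c i * d⁻¹ ^ c (i + k)) - Finsupp.single k (d ^ c i * d⁻¹ ^ c k) +
        Finsupp.single 0 (d ^ c i * (1 + (1 - d) * (c i + c k - c (i + k)))) := by
  have hs : ∀ (j : ℕ) (x : K), rowAct (countMat d c) (Finsupp.single j x) =
      Finsupp.single 0 (x * d ^ c (j + 1)) - Finsupp.single 1 (x * d ^ c j) +
        Finsupp.single (j + 1) (x * (d ^ c j * d⁻¹ ^ c (j + 1))) := by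
    intro j x
    rw [show Finsupp.single j x = x • Finsupp.single j (1 : K) by simp, map_smul,
      rowAct_single_one, countMat]
    simp only [smul_add, smul_sub, Finsupp.smul_single, smul_eq_mul]
  have hinv : ∀ m : ℕ, d⁻¹ ^ m * d ^ m = 1 := fun m => by
    rw [← mul_pow, inv_mul_cancel₀ hd, one_pow]
  induction k with
  | zero => simp [h0, hd]
  -- Applying `M` to the `E_{i+k}` and `E_k` terms gives opposite multiples of `E_1`, which cancel;
  -- `E_0` is fixed because `c 0 = c 1 = 0`.
  | succ k ih =>
    rw [pow_succ', Module.End.mul_apply, ih, map_add, map_sub, hs, hs, hs, h0, h1]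
    have e1 : ∀ m n : ℕ, d ^ c i * d⁻¹ ^ c m * (d ^ c m * d⁻¹ ^ c n) = d ^ c i * d⁻¹ ^ c n := by
      intro m n
      linear_combination (d ^ c i * d⁻¹ ^ c n) * hinv (c m)
    have e2 : ∀ m, d ^ c i * d⁻¹ ^ c m * d ^ c m = d ^ c i := by
      intro m
      linear_combination (d ^ c i) * hinv (c m)
    -- An increment `δ ∈ {0, 1}` satisfies `d^δ = 1 - (1-d)δ`, which makes the `E_0` coefficient
    -- telescope.
    have e3 : ∀ m, d ^ c i * d⁻¹ ^ c m * d ^ c (m + 1) =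
        d ^ c i * (1 - (1 - d) * (c (m + 1) - c m)) := by
      intro m
      rcases hc m with h | h
      · rw [h, e2]; ring
      · rw [h, pow_succ, ← mul_assoc, e2]; push_cast; ring
    rw [e1, e1, e2, e2, e3, e3, show i + (k + 1) = i + k + 1 by omega]
    simp only [pow_zero, mul_one, zero_add]
    have e4 : d ^ c i * (1 + (1 - d) * ((c i : K) + c (k + 1) - c (i + k + 1))) =
        d ^ c i * (1 - (1 - d) * (c (i + k + 1) - c (i + k))) -
          d ^ c i * (1 - (1 - d) * (c (k + 1) - c k)) +
          d ^ c i * (1 + (1 - d) * ((c i : K) + c k - c (i + k))) := by ring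
    rw [e4, Finsupp.single_add, Finsupp.single_sub]
    abel

/-- Only `j = 0, 1, k+1` contribute. The `E_{k+1}` terms from `j = 0` and `j = 1` cancel, which
leaves `E_0`, `E_1` and `E_{i+k+1}`. -/
theorem shiftComb_countMat (hd : d ≠ 0) (h0 : c 0 = 0) (h1 : c 1 = 0)
    (hc : ∀ j, c (j + 1) = c j ∨ c (j + 1) = c j + 1) (k i : ℕ) :
    shiftComb (countMat d c) (k + 1) i (countMat d c k) =
      Finsupp.single 0
          (d ^ (c i + c (k + 1)) * (1 + (1 - d) * (c i + c (k + 1) - c (i + (k + 1))))) -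
        Finsupp.single 1 (d ^ (c i + c k) * (1 + (1 - d) * (c i + c k - c (i + k)))) +
        Finsupp.single (i + (k + 1))
          (d ^ (c i + c (k + 1)) * d⁻¹ ^ c (i + (k + 1)) - d ^ (c i + c k) * d⁻¹ ^ c (i + k) +
            d ^ c k * d⁻¹ ^ c (k + 1)) := by
  have hs : ∀ (j : ℕ) (x : K), shiftComb (countMat d c) (k + 1) i (Finsupp.single j x) =
      x • shiftComb (countMat d c) (k + 1) i (Finsupp.single j 1) := by
    intro j x
    rw [← map_smul]
    simp
  have hinv : ∀ m : ℕ, d ^ m * d⁻¹ ^ m = 1 := fun m => by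
    rw [← mul_pow, mul_inv_cancel₀ hd, one_pow]
  have e : ∀ m, d ^ c m * (d ^ c i * d⁻¹ ^ c m) = d ^ c i := by
    intro m
    linear_combination (d ^ c i) * hinv (c m)
  conv_lhs => rw [countMat]
  rw [map_add, map_sub, hs, hs 1, hs (k + 1), shiftComb_single, shiftComb_single, shiftComb_single,
    Nat.sub_zero, Nat.add_sub_cancel, Nat.sub_self, rowAct_countMat_pow_single hd h0 h1 hc,
    rowAct_countMat_pow_single hd h0 h1 hc, pow_zero (rowAct (countMat d c)),
    Module.End.one_apply]
  simp only [map_add, map_sub, rowAct_shiftY_pow_single, smul_add, smul_sub, Finsupp.smul_single,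
    smul_eq_mul, mul_one, add_zero, zero_add, add_assoc, e]
  have e' : ∀ (m : ℕ) (x : K), d ^ c m * (d ^ c i * x) = d ^ (c i + c m) * x := by
    intro m x
    ring
  simp only [e', Finsupp.single_add, Finsupp.single_sub]
  abel

/-- `countMat d c` satisfies the shift relations if and only if `c` is additive up to an excess
of at most one. -/
theorem countMat_shift_iff (hd : d ≠ 0) (hd1 : d ≠ 1) (h0 : c 0 = 0) (h1 : c 1 = 0)
    (hc : ∀ j, c (j + 1) = c j ∨ c (j + 1) = c j + 1) :
    (∀ k i, countMat d c (i + k) = shiftComb (countMat d c) (k + 1) i (countMat d c k)) ↔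
      ∀ i k, c i + c k ≤ c (i + k) ∧ c (i + k) ≤ c i + c k + 1 := by
  constructor
  · intro h
    -- Comparison of the `E_1` entries; for `i = k = 0` the terms `E_1` and `E_{i+k+1}` would
    -- coincide.
    have key : ∀ i k, 1 ≤ i + k →
        d ^ c (i + k) = d ^ (c i + c k) * (1 + (1 - d) * (c i + c k - c (i + k))) := by
      intro i k hik
      have := DFunLike.congr_fun (h k i) 1
      rw [shiftComb_countMat hd h0 h1 hc, countMat] at this
      simpa [show i + k + 1 ≠ 1 by omega, show i + (k + 1) ≠ 1 by omega,
        show ¬ (i = 0 ∧ k = 0) by omega, Finsupp.single_apply] using this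
    have hsq : (d - 1) ^ 2 ≠ 0 := pow_ne_zero _ (sub_ne_zero.2 hd1)
    intro i k
    induction k with
    | zero => simp [h0]
    | succ k ih =>
      have hk := key i (k + 1) (by omega)
      -- Other excesses may solve the entry equation in some fields, so only the neighbours `-1` and
      -- `2` of the allowed range are excluded; the unit steps of `c` do the rest.
      have hne1 : c (i + (k + 1)) + 1 ≠ c i + c (k + 1) := by
        intro hx
        have hx' := congrArg (Nat.cast : ℕ → K) hx.symm
        push_cast at hx'
        rw [← hx, hx', pow_succ, mul_assoc] at hk
        have := mul_left_cancel₀ (pow_ne_zero _ hd) ((mul_one _).trans hk)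
        exact hsq (by linear_combination this)
      have hne2 : c (i + (k + 1)) ≠ c i + c (k + 1) + 2 := by
        intro hx
        have hx' := congrArg (Nat.cast : ℕ → K) hx
        push_cast at hx'
        rw [hx', hx, pow_add] at hk
        have := mul_left_cancel₀ (pow_ne_zero _ hd) hk
        exact hsq (by linear_combination this)
      have := hc k
      have := hc (i + k)
      rw [add_assoc] at this
      omega
  · intro h k i
    have hg : ∀ i k, d ^ c (i + k) =
        d ^ (c i + c k) * (1 + (1 - d) * (c i + c k - c (i + k))) := by
      intro i k
      have : c (i + k) = c i + c k ∨ c (i + k) = c i + c k + 1 := by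
        have := h i k
        omega
      rcases this with h | h
      · rw [h]; push_cast; ring
      · rw [h]; push_cast; ring
    rw [shiftComb_countMat hd h0 h1 hc, countMat, ← hg, ← hg, add_assoc i k 1]
    congr 2
    have hik : c (i + k) = c i + c k ∨ c (i + k) = c i + c k + 1 := by
      have := h i k
      omega
    have hik' : c (i + (k + 1)) = c i + c (k + 1) ∨ c (i + (k + 1)) = c i + c (k + 1) + 1 := by
      have := h i (k + 1)
      omega
    have hstep := hc (i + k)
    rw [add_assoc] at hstep
    -- With `s`, `s'` the excesses at `k`, `k+1` and `δ`, `ε` the increments of `c` at `k`, `i+k`,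
    -- one has `s' + δ = s + ε` with all four in `{0, 1}`. Hence `{s', δ} = {s, ε}` as multisets and
    -- `d^{-s'} + d^{-δ} = d^{-s} + d^{-ε}`.
    rcases hik with e | e <;> rcases hik' with e' | e' <;> rcases hc k with f | f <;>
      first
      | omega
      | simp only [e, e', f, inv_pow]
        field_simp
        try ring

end CountingMatrix

/-! ### The counting function of a sequence -/

section Sequences

/-- The number of `r ≥ 1` with `L_r < j`. -/
def countBelow (L : ℕ → ℕ) : ℕ → ℕ
  | 0 => 0
  | j + 1 => levelOf L j

variable {n : ℕ} {L : ℕ → ℕ}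

theorem IsDeltaSeq.le_levelOf_iff (hn : 1 ≤ n) (hL : IsDeltaSeq n L) {r : ℕ} (hr : 1 ≤ r)
    (j : ℕ) : r ≤ levelOf L j ↔ L r ≤ j := by
  obtain ⟨k, h1, h2⟩ : ∃ k, (1 ≤ k → L k ≤ j) ∧ j < L (k + 1) := by
    have hex : ∃ k, j < L (k + 1) := ⟨j, hL.le_apply hn (by omega)⟩
    refine ⟨Nat.find hex, fun hk => ?_, Nat.find_spec hex⟩
    have := Nat.find_min hex (m := Nat.find hex - 1) (by omega)
    rwa [Nat.sub_add_cancel hk, not_lt] at this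
  rw [hL.levelOf_eq hn h1 h2]
  constructor
  · intro hrk
    rcases hrk.lt_or_eq with h | rfl
    · exact (hL.strictMono hn hr h).le.trans (h1 (by omega))
    · exact h1 hr
  · intro hrj
    by_contra hc
    rcases (show k + 1 ≤ r by omega).lt_or_eq with h | rfl
    · have := hL.strictMono hn (by omega) h
      omega
    · omega

/-- The adjunction between `L` and its counting function, through which inequalities are carried
from one to the other. -/
theorem IsDeltaSeq.le_countBelow_iff (hn : 1 ≤ n) (hL : IsDeltaSeq n L) {r : ℕ} (hr : 1 ≤ r)
    (j : ℕ) : r ≤ countBelow L j ↔ L r < j := by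
  cases j with
  | zero => simp [countBelow]; omega
  | succ j => rw [countBelow, hL.le_levelOf_iff hn hr, Nat.lt_succ_iff]

theorem IsDeltaSeq.countBelow_of_eq (hn : 1 ≤ n) (hL : IsDeltaSeq n L) {j : ℕ}
    (h : 1 ≤ levelOf L j ∧ L (levelOf L j) = j) : countBelow L j + 1 = levelOf L j := by
  obtain ⟨h1, h2⟩ := h
  have h3 := hL.le_countBelow_iff hn h1 j
  rcases Nat.lt_or_ge 1 (levelOf L j) with h4 | h4
  · have h5 := hL.le_countBelow_iff hn (r := levelOf L j - 1) (by omega) j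
    have h6 := hL.strictMono hn (i := levelOf L j - 1) (j := levelOf L j) (by omega) (by omega)
    omega
  · omega

theorem IsDeltaSeq.countBelow_of_ne (hn : 1 ≤ n) (hL : IsDeltaSeq n L) {j : ℕ}
    (h : ¬ (1 ≤ levelOf L j ∧ L (levelOf L j) = j)) : countBelow L j = levelOf L j := by
  refine le_antisymm ?_ ?_
  · by_contra hc
    have h1 := (hL.le_countBelow_iff hn (r := countBelow L j) (by omega) j).1 le_rfl
    have h2 := (hL.le_levelOf_iff hn (r := countBelow L j) (by omega) j).2 h1.le
    omega
  · by_cases h1 : 1 ≤ levelOf L j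
    · have h2 := (hL.le_levelOf_iff hn h1 j).1 le_rfl
      exact (hL.le_countBelow_iff hn h1 j).2 (by omega)
    · omega

theorem IsDeltaSeq.countBelow_succ (hn : 1 ≤ n) (hL : IsDeltaSeq n L) (j : ℕ) :
    countBelow L (j + 1) = countBelow L j ∨ countBelow L (j + 1) = countBelow L j + 1 := by
  by_cases h : 1 ≤ levelOf L j ∧ L (levelOf L j) = j
  · exact Or.inr (hL.countBelow_of_eq hn h).symm
  · exact Or.inl (hL.countBelow_of_ne hn h).symm

theorem matOfSeq_add_shiftY {K : Type*} [Field K] (hn : 1 ≤ n) (hL : IsDeltaSeq n L) {a : K}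
    (ha1 : a ≠ -1) : matOfSeq a L + shiftY K = countMat (1 / (a + 1)) (countBelow L) := by
  have ha : a + 1 ≠ 0 := fun h => ha1 (eq_neg_of_add_eq_zero_left h)
  funext j
  rw [Pi.add_apply, matOfSeq, shiftY, countMat]
  split_ifs with h
  · have hc := hL.countBelow_of_eq hn h
    rw [show countBelow L (j + 1) = levelOf L j from rfl, ← hc, Nat.add_sub_cancel,
      add_assoc, ← Finsupp.single_add]
    congr 2
    rw [one_div, inv_inv, inv_pow]
    field_simp
    ring
  · rw [show countBelow L (j + 1) = levelOf L j from rfl, hL.countBelow_of_ne hn h, smul_sub,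
      Finsupp.smul_single, Finsupp.smul_single, smul_eq_mul, mul_one]
    congr 2
    rw [one_div, inv_inv, inv_pow]
    field_simp

/-- The adjunction reverses inequalities: superadditivity of the count matches `L r ≤ L j + L (r -
j) + 1`, and its excess of at most one matches `L j + L (r - j) ≤ L r`. -/
theorem IsDeltaSeq.isQuasiBalanced_iff (hn : 1 ≤ n) (hL : IsDeltaSeq n L) :
    IsQuasiBalanced L ↔ ∀ i k, countBelow L i + countBelow L k ≤ countBelow L (i + k) ∧
      countBelow L (i + k) ≤ countBelow L i + countBelow L k + 1 := by
  have hle := fun {r : ℕ} (hr : 1 ≤ r) (j : ℕ) => hL.le_countBelow_iff hn hr j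
  constructor
  · intro h i k
    constructor
    · by_cases hi : countBelow L i = 0
      · rw [hi, zero_add]
        by_cases hk : countBelow L k = 0
        · omega
        · have h1 := (hle (r := countBelow L k) (by omega) k).1 le_rfl
          exact (hle (by omega) _).2 (by omega)
      · have h1 := (hle (r := countBelow L i) (by omega) i).1 le_rfl
        by_cases hk : countBelow L k = 0
        · rw [hk, add_zero]
          exact (hle (by omega) _).2 (by omega)
        · have h2 := (hle (r := countBelow L k) (by omega) k).1 le_rfl
          have h3 := (h (countBelow L i + countBelow L k) (countBelow L i)
            (by omega) (by omega)).1
          rw [Nat.add_sub_cancel_left] at h3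
          exact (hle (by omega) _).2 (by omega)
    · by_contra hc
      have h1 := hle (r := countBelow L i + 1) (by omega) i
      have h2 := hle (r := countBelow L k + 1) (by omega) k
      have h3 := (hle (r := countBelow L i + 1 + (countBelow L k + 1)) (by omega) (i + k)).1
        (by omega)
      have h4 := (h (countBelow L i + 1 + (countBelow L k + 1)) (countBelow L i + 1)
        (by omega) (by omega)).2
      rw [Nat.add_sub_cancel_left] at h4
      omega
  · intro h r j hj hjr
    constructor
    · have h1 := (hle hj (L j + 1)).2 (by omega)
      have h2 := (hle (r := r - j) (by omega) (L (r - j) + 1)).2 (by omega)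
      have h3 := (h (L j + 1) (L (r - j) + 1)).1
      have h4 := (hle (r := r) (by omega) (L j + 1 + (L (r - j) + 1))).1 (by omega)
      omega
    · by_contra hc
      -- At `L j` the count is still below `j`, so the two counts sum to at most `r - 2`, while a
      -- failure would make the count at the sum at least `r`.
      have h1 := hle hj (L j)
      have h2 := hle (r := r - j) (by omega) (L (r - j))
      have h3 := (h (L j) (L (r - j))).2
      have h4 := (hle (r := r) (by omega) (L j + L (r - j))).2 (by omega)
      omega

end Sequences

theorem mainTheorem1 {K : Type*} [Field K] (n : ℕ) (hn : 2 ≤ n) (a : K) (ha0 : a ≠ 0)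
    (ha1 : a ≠ -1) (L : ℕ → ℕ) (hL : IsDeltaSeq n L) (M : InfMat K)
    (hM : M = matOfSeq a L + shiftY K) :
    (IsGradedTwistingMap (twistOfMatrix M) ↔ IsQuasiBalanced L) ∧
    (IsGradedTwistingMatrix M ↔ IsQuasiBalanced L) ∧
    ((∃ τ : K[X] ⊗[K] K[X] →ₗ[K] K[X] ⊗[K] K[X], IsGradedTwistingMap τ ∧ HasMatrix τ M) ↔
      IsQuasiBalanced L) ∧
    (IsQuasiBalanced L →
      HasMatrix (twistOfMatrix M) M ∧
      IsTwistedTensorProduct (twistedMul (twistOfMatrix M)) ∧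
      ∀ k : ℕ, twistedMul (twistOfMatrix M)
          ((1 : K[X]) ⊗ₜ[K] (Polynomial.X ^ k : K[X])) ((Polynomial.X : K[X]) ⊗ₜ[K] (1 : K[X])) =
        ∑ j ∈ Finset.range (k + 2),
          M k j • ((Polynomial.X ^ (k + 1 - j) : K[X]) ⊗ₜ[K] (Polynomial.X ^ j : K[X]))) := by
  have hn1 : 1 ≤ n := by omega
  have ha : a + 1 ≠ 0 := fun h => ha1 (eq_neg_of_add_eq_zero_left h)
  have hd : (1 / (a + 1) : K) ≠ 0 := one_div_ne_zero ha
  have hd1 : (1 / (a + 1) : K) ≠ 1 := by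
    rw [Ne, div_eq_one_iff_eq ha]
    exact fun h => ha0 (by simpa using h)
  have h1 : countBelow L 1 = 0 := by
    by_contra hc
    have := (hL.le_countBelow_iff hn1 le_rfl 1).1 (by omega)
    rw [hL.1] at this
    omega
  rw [matOfSeq_add_shiftY hn1 hL ha1] at hM
  have hess : ∀ k j, k + 1 < j → M k j = 0 := hM ▸ countMat_apply_eq_zero _ _
  have hrow : M 0 = Finsupp.single 0 1 := by
    rw [hM, countMat]
    simp [h1, show countBelow L 0 = 0 from rfl]
  have hshift : (∀ k i, M (i + k) = shiftComb M (k + 1) i (M k)) ↔ IsQuasiBalanced L := by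
    rw [hM, hL.isQuasiBalanced_iff hn1]
    exact countMat_shift_iff hd hd1 rfl h1 (hL.countBelow_succ hn1)
  have hmat : IsQuasiBalanced L → IsGradedTwistingMatrix M := fun h =>
    ⟨hrow, hess, fun k => (shift_mul_iff hess k).2 (hshift.2 h k)⟩
  have hH : HasMatrix (twistOfMatrix M) M := (isTwistOf_twistOfMatrix M).hasMatrix hess
  have hmap : ∀ τ, IsGradedTwistingMap τ → HasMatrix τ M → IsQuasiBalanced L := fun τ h hτ =>
    hshift.1 (h.isTwistingMap.shift_mul hess hτ)
  refine ⟨⟨fun h => hmap _ h hH, fun h => (hmat h).isGradedTwistingMap⟩,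
    ⟨fun h => hshift.1 fun k => (shift_mul_iff hess k).1 (h.shift_mul k), hmat⟩,
    ⟨fun ⟨τ, h, hτ⟩ => hmap τ h hτ, fun h => ⟨_, (hmat h).isGradedTwistingMap, hH⟩⟩,
    fun h => ⟨hH, (hmat h).isTwistingMap.isTwistedTensorProduct, fun k => ?_⟩⟩
  rw [twistedMul_one_tmul_tmul_one]
  exact hH k
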